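/- All rings are associative with $1$, subrings contain the same $1$, and modules are unital. Let $R$ be a ring. A submodule $K$ of a module $F$ is small if $K+Y=F$ implies $Y=F$ for every submodule $Y$ of $F$. A homomorphism $f\colon F\to M$ of right $R$-modules is a $G$-flat cover of $M$ if $F$ is flat, $f$ is onto and $\ker f$ is small in $F$; the ring $R$ is right $G$-perfect if every right $R$-module has a $G$-flat cover. A homomorphism $f\colon F\to M$ of right $R$-modules is a flat cover of $M$ (in the sense of Enochs) if $F$ is flat, every homomorphism $C\to M$ from a flat right $R$-module $C$ factors through $f$, and every endomorphism $g$ of $F$ with $f=fg$ is bijective. A ring $T$ is von Neumann regular if for every $a\in T$ there is $b\in T$ with $aba=a$. **Theorem 3.5.** Let $S$ be a subring of a ring $T$. Assume that $T$ is von Neumann regular and that $S$ is right $G$-perfect. Then $$R=\{(x_1,x_2,\ldots,x_n,x,x,\ldots)\mid n\in\mathbb{N},\ x_i\in T,\ x\in S\}\subseteq T^{\mathbb{N}},$$ with componentwise operations, is a right $G$-perfect ring whose Jacobson radical is $J(R)=0$. Moreover, if every flat cover of a right $S$-module is a $G$-flat cover, then every flat cover of a right $R$-module is a $G$-flat cover.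 -/

import Mathlib

open scoped TensorProduct

universe u v w

/- Right modules over a ring `R` are modules over `Rᵐᵒᵖ`: the product `m r` is
`MulOpposite.op r • m`. -/

/-- A ring is von Neumann regular if every element `a` can be written as `a = a b a`. -/
def IsVonNeumannRegularRing (R : Type u) [Ring R] : Prop :=
  ∀ a : R, ∃ b : R, a * b * a = a

/-- The subgroup of `M ⊗[ℤ] N` generated by the elements `m r ⊗ n - m ⊗ r n`. -/
def balancingRelations (R : Type u) [Ring R] (M : Type v) [AddCommGroup M] [Module Rᵐᵒᵖ M]
    (N : Type w) [AddCommGroup N] [Module R N] : AddSubgroup (M ⊗[ℤ] N) :=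
  AddSubgroup.closure {z | ∃ (m : M) (r : R) (n : N),
    z = (MulOpposite.op r • m) ⊗ₜ[ℤ] n - m ⊗ₜ[ℤ] (r • n)}

/-- The tensor product `M ⊗_R N` of a right module `M` and a left module `N` over a not
necessarily commutative ring `R`, as an abelian group. -/
abbrev BalancedTensor (R : Type u) [Ring R] (M : Type v) [AddCommGroup M] [Module Rᵐᵒᵖ M]
    (N : Type w) [AddCommGroup N] [Module R N] : Type (max v w) :=
  (M ⊗[ℤ] N) ⧸ balancingRelations R M N

theorem balancingRelations_le_comap (R : Type u) [Ring R]
    (M : Type v) [AddCommGroup M] [Module Rᵐᵒᵖ M]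
    {N N' : Type w} [AddCommGroup N] [Module R N] [AddCommGroup N'] [Module R N']
    (f : N →ₗ[R] N') :
    balancingRelations R M N ≤ (balancingRelations R M N').comap
      (f.toAddMonoidHom.toIntLinearMap.lTensor M).toAddMonoidHom := by
  refine (AddSubgroup.closure_le _).2 ?_
  rintro _ ⟨m, r, n, rfl⟩
  refine AddSubgroup.subset_closure ⟨m, r, f n, ?_⟩
  simp

/-- The homomorphism `M ⊗_R f : M ⊗_R N → M ⊗_R N'` induced by `f : N → N'`; it maps the class
of `m ⊗ n` to the class of `m ⊗ f n`. -/
def BalancedTensor.map (R : Type u) [Ring R] (M : Type v) [AddCommGroup M] [Module Rᵐᵒᵖ M]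
    {N N' : Type w} [AddCommGroup N] [Module R N] [AddCommGroup N'] [Module R N']
    (f : N →ₗ[R] N') : BalancedTensor R M N →+ BalancedTensor R M N' :=
  QuotientAddGroup.map (balancingRelations R M N) (balancingRelations R M N')
    (f.toAddMonoidHom.toIntLinearMap.lTensor M).toAddMonoidHom
    (balancingRelations_le_comap R M f)

/-- A right `R`-module `M` is flat if `M ⊗_R -` preserves injectivity of homomorphisms of
left `R`-modules. -/
def IsRightFlat (R : Type u) [Ring R] (M : Type v) [AddCommGroup M] [Module Rᵐᵒᵖ M] : Prop :=
  ∀ (N N' : Type u) [AddCommGroup N] [Module R N] [AddCommGroup N'] [Module R N']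
    (f : N →ₗ[R] N'), Function.Injective f → Function.Injective (BalancedTensor.map R M f)

/-- A submodule `K` of `M` is small if `K + Y = M` implies `Y = M` for all submodules `Y`. -/
def IsSmallSubmodule {A : Type u} [Ring A] {M : Type v} [AddCommGroup M] [Module A M]
    (K : Submodule A M) : Prop :=
  ∀ Y : Submodule A M, K ⊔ Y = ⊤ → Y = ⊤

/-- `f : F → M` is a G-flat cover: `F` is flat, `f` is onto and its kernel is small in `F`. -/
structure IsGFlatCover (R : Type u) [Ring R] {F M : Type v}
    [AddCommGroup F] [Module Rᵐᵒᵖ F] [AddCommGroup M] [Module Rᵐᵒᵖ M]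
    (f : F →ₗ[Rᵐᵒᵖ] M) : Prop where
  flat : IsRightFlat R F
  surjective : Function.Surjective f
  small_ker : IsSmallSubmodule (LinearMap.ker f)

/-- A ring is right G-perfect if every right module has a G-flat cover. -/
def IsRightGPerfect (R : Type u) [Ring R] : Prop :=
  ∀ (M : Type v) [AddCommGroup M] [Module Rᵐᵒᵖ M],
    ∃ (F : Type v) (_ : AddCommGroup F) (_ : Module Rᵐᵒᵖ F) (f : F →ₗ[Rᵐᵒᵖ] M),
      IsGFlatCover R f

/-- `f : F → M` is a flat precover: `F` is flat and every homomorphism from a flat module to `M`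
factors through `f`. -/
structure IsFlatPrecover (R : Type u) [Ring R] {F M : Type v}
    [AddCommGroup F] [Module Rᵐᵒᵖ F] [AddCommGroup M] [Module Rᵐᵒᵖ M]
    (f : F →ₗ[Rᵐᵒᵖ] M) : Prop where
  flat : IsRightFlat R F
  lift : ∀ (C : Type v) [AddCommGroup C] [Module Rᵐᵒᵖ C], IsRightFlat R C →
    ∀ g : C →ₗ[Rᵐᵒᵖ] M, ∃ h : C →ₗ[Rᵐᵒᵖ] F, f ∘ₗ h = g

/-- `f : F → M` is right minimal if every endomorphism `g` of `F` with `f = f g` is bijective. -/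
def IsRightMinimal {A : Type u} [Ring A] {F M : Type v}
    [AddCommGroup F] [Module A F] [AddCommGroup M] [Module A M] (f : F →ₗ[A] M) : Prop :=
  ∀ g : F →ₗ[A] F, f = f ∘ₗ g → Function.Bijective g

/-- `f : F → M` is a flat cover (in the sense of Enochs): a right minimal flat precover. -/
structure IsFlatCover (R : Type u) [Ring R] {F M : Type v}
    [AddCommGroup F] [Module Rᵐᵒᵖ F] [AddCommGroup M] [Module Rᵐᵒᵖ M]
    (f : F →ₗ[Rᵐᵒᵖ] M) : Prop extends IsFlatPrecover R f where
  minimal : IsRightMinimal f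

/-- Every flat cover of a right `R`-module is a G-flat cover. -/
def FlatCoversAreGFlatCovers (R : Type u) [Ring R] : Prop :=
  ∀ (F M : Type v) [AddCommGroup F] [Module Rᵐᵒᵖ F] [AddCommGroup M] [Module Rᵐᵒᵖ M]
    (f : F →ₗ[Rᵐᵒᵖ] M), IsFlatCover R f → IsGFlatCover R f

/-- For a subring `S` of `T`, the ring of sequences `(x₁, …, xₙ, x, x, …)` with `xᵢ ∈ T` and
`x ∈ S`, with componentwise operations. -/
def eventuallyConstantSubring {T : Type u} [Ring T] (S : Subring T) : Subring (ℕ → T) where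
  carrier := {a | ∃ x ∈ S, ∃ n : ℕ, ∀ i, n ≤ i → a i = x}
  mul_mem' := by
    rintro a b ⟨x, hx, n, hn⟩ ⟨y, hy, m, hm⟩
    refine ⟨x * y, S.mul_mem hx hy, max n m, fun i hi => ?_⟩
    rw [Pi.mul_apply, hn i (le_of_max_le_left hi), hm i (le_of_max_le_right hi)]
  one_mem' := ⟨1, S.one_mem, 0, fun _ _ => rfl⟩
  add_mem' := by
    rintro a b ⟨x, hx, n, hn⟩ ⟨y, hy, m, hm⟩
    refine ⟨x + y, S.add_mem hx hy, max n m, fun i hi => ?_⟩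
    rw [Pi.add_apply, hn i (le_of_max_le_left hi), hm i (le_of_max_le_right hi)]
  zero_mem' := ⟨0, S.zero_mem, 0, fun _ _ => rfl⟩
  neg_mem' := by
    rintro a ⟨x, hx, n, hn⟩
    exact ⟨-x, S.neg_mem hx, n, fun i hi => by rw [Pi.neg_apply, hn i hi]⟩

/-!
Write `R` for the ring of eventually constant sequences, `u n = (1, …, 1, 0, 0, …)` for its central
idempotents, and `I` for the ideal of finitely supported sequences, the union of the ideals
`u n * R`. Taking eventual values identifies `R / I` with `S`, and constant sequences split this
retraction. For a module `M` over `R`, the submodule `M I` consists of the elements fixed by some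
`u n` (the "torsion" of `M`), and `M / M I` is a module over `S` (the "reduction" of `M`).

The central fact is that `M` is flat over `R` if and only if `M / M I` is flat over `S`
(`IsReduction.isRightFlat` and `IsReduction.isRightFlat_of_isLocallyRegular`). For the harder
direction, let `N → N'` be injective and let `z ∈ M ⊗_R N` become zero in `M ⊗_R N'`. Flatness of
the reduction gives `z = e z` for some `e = u k`, so it suffices that each `e = u k` kills `z`. By
the equational criterion, `z = ∑ m i ⊗ x i` where `x = A y` with a vector `y` over `N'`, and
`m A = 0`. Matrices over the regular ring `T` have generalized inverses, so there is a matrix `B`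
over `R` with `e A B A = e A`; hence `e x = A (e B x)`, where `e B x` has entries in `N`, and
`m A = 0` gives `e z = ∑ m i ⊗ e x i = 0` already in `M ⊗_R N`.

Consequently, for an `S`-homomorphism `X → M / M I` with `X` flat, the pullback `M ×_{M / M I} X`,
whose reduction is `X`, is flat over `R`. The kernel of its projection to `M` meets the torsion
trivially, and such a submodule is small as soon as its image in the reduction is contained in a
small submodule (`IsReduction.isSmallSubmodule`). So pulling back a G-flat cover of `M / M I` gives
a G-flat cover of `M`. If `f : F → M` is a flat cover, then comparing `F` with the flat pullback of
`M` and the reduction of `F` shows that `f` induces a flat cover of reductions and that `ker f`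
meets the torsion trivially (`IsReduction.isFlatCover`); thus smallness of the kernel passes from
`S` to `R`. Finally `J(R) = 0` because each nonzero left ideal of `R` contains a nonzero idempotent.
-/

/-! ### Matrices over von Neumann regular rings -/

namespace IsVonNeumannRegularRing

open Matrix

variable {T : Type u} [Ring T]

/-- Generalized inverses extend from `A` to the block matrix `[A C]`: it is enough to have one for
`(1 - A B) C`, the part of `C` outside the column space of `A`. -/
theorem exists_fromCols_mul_mul {k l l' : Type*} [Fintype k] [Fintype l] [Fintype l']
    (h : ∀ C : Matrix k l' T, ∃ D : Matrix l' k T, C * D * C = C)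
    (A : Matrix k l T) {B : Matrix l k T} (hB : A * B * A = A) (C : Matrix k l' T) :
    ∃ X : Matrix (l ⊕ l') k T, fromCols A C * X * fromCols A C = fromCols A C := by
  classical
  obtain ⟨D, hD⟩ := h ((1 - A * B) * C)
  have hA : (1 - A * B) * A = 0 := by rw [Matrix.sub_mul, hB, Matrix.one_mul, sub_self]
  refine ⟨fromRows (B - B * C * D * (1 - A * B)) (D * (1 - A * B)), ?_⟩
  have hg : fromCols A C * fromRows (B - B * C * D * (1 - A * B)) (D * (1 - A * B)) =
      A * B + (1 - A * B) * C * D * (1 - A * B) := by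
    rw [fromCols_mul_fromRows]
    simp only [Matrix.mul_sub, Matrix.sub_mul, Matrix.one_mul, Matrix.mul_one,
      Matrix.mul_assoc]
    abel
  rw [hg, mul_fromCols]
  congr 1
  · rw [Matrix.add_mul, hB, Matrix.mul_assoc, hA, Matrix.mul_zero, add_zero]
  · rw [Matrix.add_mul, Matrix.mul_assoc _ (1 - A * B) C, hD, Matrix.sub_mul, Matrix.one_mul]
    abel

/-- The analogue of `exists_fromCols_mul_mul` for adding rows. -/
theorem exists_fromRows_mul_mul {k k' l : Type*} [Fintype k] [Fintype k'] [Fintype l]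
    (h : ∀ C : Matrix k' l T, ∃ D : Matrix l k' T, C * D * C = C)
    (A : Matrix k l T) {B : Matrix l k T} (hB : A * B * A = A) (C : Matrix k' l T) :
    ∃ X : Matrix l (k ⊕ k') T, fromRows A C * X * fromRows A C = fromRows A C := by
  classical
  obtain ⟨D, hD⟩ := h (C * (1 - B * A))
  have hA : A * (1 - B * A) = 0 := by
    rw [Matrix.mul_sub, ← Matrix.mul_assoc, hB, Matrix.mul_one, sub_self]
  refine ⟨fromCols (B - (1 - B * A) * D * C * B) ((1 - B * A) * D), ?_⟩
  have hg : fromCols (B - (1 - B * A) * D * C * B) ((1 - B * A) * D) * fromRows A C =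
      B * A + (1 - B * A) * D * (C * (1 - B * A)) := by
    rw [fromCols_mul_fromRows]
    simp only [Matrix.mul_sub, Matrix.sub_mul, Matrix.one_mul, Matrix.mul_one,
      Matrix.mul_assoc]
    abel
  rw [Matrix.mul_assoc, hg, fromRows_mul]
  congr 1
  · rw [Matrix.mul_add, ← Matrix.mul_assoc, hB, Matrix.mul_assoc (1 - B * A),
      ← Matrix.mul_assoc A, hA, Matrix.zero_mul, add_zero]
  · rw [Matrix.mul_add, ← Matrix.mul_assoc C ((1 - B * A) * D), ← Matrix.mul_assoc C (1 - B * A),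
      hD, Matrix.mul_sub, Matrix.mul_one]
    abel

theorem mul_submatrix_symm_mul {k k' l l' : Type*} [Fintype k] [Fintype k'] [Fintype l]
    [Fintype l'] (e : k ≃ k') (g : l ≃ l') (C : Matrix k' l' T) {D : Matrix l k T}
    (h : C.submatrix e g * D * C.submatrix e g = C.submatrix e g) :
    C * D.submatrix g.symm e.symm * C = C := by
  have hD : D = (D.submatrix g.symm e.symm).submatrix g e := by simp
  rw [hD, Matrix.submatrix_mul_equiv, Matrix.submatrix_mul_equiv] at h
  simpa using congr_arg (fun X => X.submatrix e.symm g.symm) h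

theorem exists_column_mul_mul (hT : IsVonNeumannRegularRing T) (k : Type*) [Finite k] :
    ∀ [Fintype k] (C : Matrix k Unit T), ∃ D : Matrix Unit k T, C * D * C = C := by
  induction k using Finite.induction_empty_option with
  | @of_equiv k k' e h =>
    intro _ C
    have := Fintype.ofEquiv k' e.symm
    obtain ⟨D, hD⟩ := h (C.submatrix e id)
    exact ⟨_, mul_submatrix_symm_mul e (Equiv.refl Unit) C hD⟩
  | h_empty => exact fun C => ⟨0, Subsingleton.elim _ _⟩
  | @h_option k _ h =>
    intro _ C
    have h₁ : ∀ C : Matrix Unit Unit T, ∃ D : Matrix Unit Unit T, C * D * C = C := by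
      intro C
      obtain ⟨b, hb⟩ := hT (C () ())
      refine ⟨Matrix.of fun _ _ => b, ?_⟩
      ext
      simp only [Matrix.mul_apply, Finset.univ_unique, Finset.sum_singleton]
      exact hb
    let e : k ⊕ Unit ≃ Option k := (Equiv.optionEquivSumPUnit k).symm
    obtain ⟨B, hB⟩ := h (C.submatrix (e ∘ Sum.inl) id)
    obtain ⟨D, hD⟩ := exists_fromRows_mul_mul h₁ _ hB (C.submatrix (e ∘ Sum.inr) id)
    have hC : fromRows (C.submatrix (e ∘ Sum.inl) id) (C.submatrix (e ∘ Sum.inr) id) =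
        C.submatrix e id := by
      ext (i | i) j <;> rfl
    rw [hC] at hD
    exact ⟨_, mul_submatrix_symm_mul e (Equiv.refl Unit) C hD⟩

/-- Over a von Neumann regular ring every rectangular matrix has a generalized inverse. -/
theorem exists_matrix_mul_mul (hT : IsVonNeumannRegularRing T) {k : Type*} [Fintype k]
    (l : Type*) [Finite l] :
    ∀ [Fintype l] (A : Matrix k l T), ∃ B : Matrix l k T, A * B * A = A := by
  induction l using Finite.induction_empty_option with
  | @of_equiv l l' e h =>
    intro _ A
    have := Fintype.ofEquiv l' e.symm
    obtain ⟨D, hD⟩ := h (A.submatrix id e)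
    exact ⟨_, mul_submatrix_symm_mul (Equiv.refl k) e A hD⟩
  | h_empty => exact fun C => ⟨0, Subsingleton.elim _ _⟩
  | @h_option l _ h =>
    intro _ A
    let e : l ⊕ Unit ≃ Option l := (Equiv.optionEquivSumPUnit l).symm
    obtain ⟨B, hB⟩ := h (A.submatrix id (e ∘ Sum.inl))
    obtain ⟨D, hD⟩ := exists_fromCols_mul_mul (hT.exists_column_mul_mul k) _ hB
      (A.submatrix id (e ∘ Sum.inr))
    have hC : fromCols (A.submatrix id (e ∘ Sum.inl)) (A.submatrix id (e ∘ Sum.inr)) =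
        A.submatrix id e := by
      ext i (j | j) <;> rfl
    rw [hC] at hD
    exact ⟨_, mul_submatrix_symm_mul (Equiv.refl k) e A hD⟩

end IsVonNeumannRegularRing

/-! ### An equational criterion for vanishing in the balanced tensor product -/

section Vanishing

variable {R : Type u} [Ring R] {M : Type v} [AddCommGroup M] [Module Rᵐᵒᵖ M] {N N' : Type w}

/-- The biadditive map `(m, ∑ y, r_y [y]) ↦ ∑ y, m r_y [y]`, where a finitely supported function
`N → M` is written as a formal sum and stands for the tensor `∑ y, m_y ⊗ y`. -/
noncomputable def formalSMul (R : Type u) [Ring R] (M : Type v) [AddCommGroup M]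
    [Module Rᵐᵒᵖ M] (N : Type w) : M →+ (N →₀ R) →+ (N →₀ M) :=
  AddMonoidHom.mk' (fun m => Finsupp.mapRange.addMonoidHom
    (AddMonoidHom.mk' (fun r : R => MulOpposite.op r • m) fun r s => by
      rw [MulOpposite.op_add, add_smul])) fun m m' => by
    ext y r z
    simp [Finsupp.single_add]

theorem formalSMul_apply (m : M) (c : N →₀ R) (y : N) :
    formalSMul R M N m c y = MulOpposite.op (c y) • m := rfl

theorem formalSMul_single (m : M) (y : N) (r : R) :
    formalSMul R M N m (Finsupp.single y r) = Finsupp.single y (MulOpposite.op r • m) :=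
  Finsupp.mapRange_single (hf := by simp)

variable [AddCommGroup N] [Module R N] [AddCommGroup N'] [Module R N']

/-- The formal sums in `N →₀ M` generated by the elements `m` of `M` times the linear relations
between elements of `N`; the quotient by it is `M ⊗_R N`. -/
noncomputable def formalRelations (R : Type u) [Ring R] (M : Type v) [AddCommGroup M]
    [Module Rᵐᵒᵖ M] (N : Type w) [AddCommGroup N] [Module R N] : AddSubgroup (N →₀ M) :=
  AddSubgroup.closure {x | ∃ (m : M) (c : N →₀ R), Finsupp.linearCombination R id c = 0 ∧
    x = formalSMul R M N m c}

theorem formalSMul_mem (m : M) {c : N →₀ R} (hc : Finsupp.linearCombination R id c = 0) :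
    formalSMul R M N m c ∈ formalRelations R M N :=
  AddSubgroup.subset_closure ⟨m, c, hc, rfl⟩

theorem exists_sum_formalSMul_of_mem {x : N →₀ M} (hx : x ∈ formalRelations R M N) :
    ∃ (J : Type) (_ : Fintype J) (m : J → M) (c : J → N →₀ R),
      (∀ j, Finsupp.linearCombination R id (c j) = 0) ∧ x = ∑ j, formalSMul R M N (m j) (c j) := by
  induction hx using AddSubgroup.closure_induction with
  | mem x hx =>
    obtain ⟨m, c, hc, rfl⟩ := hx
    exact ⟨Unit, inferInstance, fun _ => m, fun _ => c, fun _ => hc, by simp⟩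
  | zero => exact ⟨Empty, inferInstance, Empty.elim, Empty.elim, fun j => j.elim, by simp⟩
  | add x y _ _ hx hy =>
    obtain ⟨J, _, m, c, hc, rfl⟩ := hx
    obtain ⟨J', _, m', c', hc', rfl⟩ := hy
    refine ⟨J ⊕ J', inferInstance, Sum.elim m m', Sum.elim c c', ?_, by simp⟩
    rintro (j | j)
    exacts [hc j, hc' j]
  | neg x _ hx =>
    obtain ⟨J, _, m, c, hc, rfl⟩ := hx
    exact ⟨J, inferInstance, fun j => -m j, c, hc, by simp⟩

/-- The homomorphism `m ⊗ y ↦ m [y]` from `M ⊗[ℤ] N` to the formal sums modulo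
`formalRelations`. -/
noncomputable def tensorToFormal (R : Type u) [Ring R] (M : Type v) [AddCommGroup M]
    [Module Rᵐᵒᵖ M] (N : Type w) [AddCommGroup N] [Module R N] :
    M ⊗[ℤ] N →+ (N →₀ M) ⧸ formalRelations R M N :=
  TensorProduct.liftAddHom
    (AddMonoidHom.mk' (fun m => AddMonoidHom.mk'
      (fun y => (QuotientAddGroup.mk (Finsupp.single y m) : (N →₀ M) ⧸ formalRelations R M N))
      fun y y' => by
        rw [← QuotientAddGroup.mk_add, eq_comm, QuotientAddGroup.eq]
        have := formalSMul_mem (R := R) m (c := Finsupp.single (y + y') 1 -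
          (Finsupp.single y 1 + Finsupp.single y' 1)) (by simp)
        rw [map_sub, map_add] at this
        simp only [formalSMul_single, MulOpposite.op_one, one_smul] at this
        rwa [neg_add_eq_sub])
      fun m m' => by
        ext y
        simp [Finsupp.single_add])
    fun r m y => by
      rw [map_zsmul, map_zsmul]
      rfl

theorem tensorToFormal_tmul (m : M) (y : N) :
    tensorToFormal R M N (m ⊗ₜ y) = QuotientAddGroup.mk (Finsupp.single y m) := rfl

theorem tensorToFormal_eq_zero {z : M ⊗[ℤ] N} (hz : z ∈ balancingRelations R M N) :
    tensorToFormal R M N z = 0 := by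
  suffices balancingRelations R M N ≤ (tensorToFormal R M N).ker from this hz
  refine (AddSubgroup.closure_le _).2 ?_
  rintro _ ⟨m, r, y, rfl⟩
  change tensorToFormal R M N _ = 0
  rw [map_sub, tensorToFormal_tmul, tensorToFormal_tmul, ← QuotientAddGroup.mk_sub,
    QuotientAddGroup.eq_zero_iff]
  have := formalSMul_mem (R := R) m (c := Finsupp.single y r - Finsupp.single (r • y) 1) (by simp)
  rw [map_sub] at this
  simpa only [formalSMul_single, MulOpposite.op_one, one_smul] using this

/-- The equational criterion for vanishing: if `z ∈ M ⊗ N` becomes zero in `M ⊗_R N'`, then `z`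
can be written as `∑ i, m i ⊗ n i` in such a way that `f (n i) = ∑ k, A i k • y k` and
`∑ i, m i * A i k = 0` for some matrix `A` over `R` and some elements `y k` of `N'`. -/
theorem exists_matrix_of_lTensor_mem_balancingRelations (f : N →ₗ[R] N') {z : M ⊗[ℤ] N}
    (hz : f.toAddMonoidHom.toIntLinearMap.lTensor M z ∈ balancingRelations R M N') :
    ∃ (ι : Type) (_ : Fintype ι) (κ : Type w) (_ : Fintype κ) (m : ι → M) (n : ι → N)
      (A : Matrix ι κ R) (y : κ → N'), z = ∑ i, m i ⊗ₜ[ℤ] n i ∧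
      (∀ i, f (n i) = ∑ k, A i k • y k) ∧ ∀ k, ∑ i, MulOpposite.op (A i k) • m i = 0 := by
  classical
  obtain ⟨d, m, n, rfl⟩ := TensorProduct.exists_sum_tmul_eq z
  have h := tensorToFormal_eq_zero hz
  simp only [map_sum, LinearMap.lTensor_tmul, tensorToFormal_tmul] at h
  rw [← QuotientAddGroup.mk_sum, QuotientAddGroup.eq_zero_iff] at h
  obtain ⟨J, _, m', c', hc', hsum⟩ := exists_sum_formalSMul_of_mem h
  let c : Fin d ⊕ J → N' →₀ R := Sum.elim (fun i => Finsupp.single (f (n i)) 1) c'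
  let s : Finset N' := Finset.univ.biUnion fun i => (c i).support
  have hc (i) : ∑ k : s, c i k • (k : N') = Finsupp.linearCombination R id (c i) := by
    rw [Finsupp.linearCombination_apply, Finsupp.sum_of_support_subset (s := s) _
      (Finset.subset_biUnion_of_mem (fun i => (c i).support) (Finset.mem_univ i)) _ (by simp)]
    exact Finset.sum_coe_sort s fun k => c i k • k
  refine ⟨Fin d ⊕ J, inferInstance, s, inferInstance, Sum.elim m fun j => -m' j,
    Sum.elim n 0, fun i k => c i k, Subtype.val, by simp, fun i => ?_, fun k => ?_⟩
  · rw [hc]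
    rcases i with i | j
    · simp [c]
    · simp [c, hc']
  · have := DFunLike.congr_fun hsum (k : N')
    simp only [Finsupp.finsetSum_apply, formalSMul_apply] at this
    simp only [Fintype.sum_sum_type, c, Sum.elim_inl, Sum.elim_inr, smul_neg,
      Finset.sum_neg_distrib, ← this, ← sub_eq_add_neg, sub_eq_zero]
    refine Finset.sum_congr rfl fun i _ => ?_
    change _ = (Finsupp.single (f (n i)) (m i)) (k : N')
    by_cases hk : f (n i) = k <;> simp [hk]

/-- If `e` is central and all matrices over `R` have generalized inverses up to the factor `e`,
then `e` annihilates every kernel `M ⊗_R N → M ⊗_R N'` with `N → N'` injective. -/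
theorem smul_mem_balancingRelations_of_regular {e : R} (he : ∀ r, e * r = r * e)
    (hreg : ∀ {ι : Type} {κ : Type w} [Fintype ι] [Fintype κ] (A : Matrix ι κ R),
      ∃ B : Matrix κ ι R, e • (A * B * A) = e • A)
    (f : N →ₗ[R] N') (hf : Function.Injective f) {z : M ⊗[ℤ] N}
    (hz : f.toAddMonoidHom.toIntLinearMap.lTensor M z ∈ balancingRelations R M N') :
    (DistribSMul.toAddMonoidHom N e).toIntLinearMap.lTensor M z ∈ balancingRelations R M N := by
  obtain ⟨ι, _, κ, _, m, n, A, y, rfl, hn, hm⟩ :=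
    exists_matrix_of_lTensor_mem_balancingRelations f hz
  obtain ⟨B, hB⟩ := hreg A
  let x : κ → N := fun k => ∑ i, B k i • n i
  have key (i : ι) : e • n i = ∑ k, A i k • e • x k := by
    apply hf
    have hx (k : κ) : f (x k) = ∑ k', (B * A) k k' • y k' := by
      simp only [x, map_sum, map_smul, hn, Finset.smul_sum, Matrix.mul_apply, Finset.sum_smul,
        smul_smul]
      exact Finset.sum_comm
    have : f (e • n i) = ∑ k, (e • A) i k • y k := by
      simp [hn, Finset.smul_sum, smul_smul]
    rw [this, ← hB]
    calc ∑ k', (e • (A * B * A)) i k' • y k'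
        = ∑ k', ∑ k, (e * (A i k * (B * A) k k')) • y k' := by
          simp only [Matrix.mul_assoc A, Matrix.smul_apply, Matrix.mul_apply (M := A),
            smul_eq_mul, Finset.mul_sum, Finset.sum_smul]
      _ = ∑ k, ∑ k', (e * (A i k * (B * A) k k')) • y k' := Finset.sum_comm
      _ = f (∑ k, A i k • e • x k) := by
          simp only [map_sum, map_smul, hx, Finset.smul_sum, smul_smul, ← mul_assoc, he (A i _)]
  rw [← QuotientAddGroup.eq_zero_iff, map_sum]
  have hbal (m : M) (r : R) (x : N) :
      (QuotientAddGroup.mk (m ⊗ₜ[ℤ] (r • x)) : BalancedTensor R M N) =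
        QuotientAddGroup.mk ((MulOpposite.op r • m) ⊗ₜ[ℤ] x) := by
    rw [QuotientAddGroup.eq, neg_add_eq_sub]
    exact AddSubgroup.subset_closure ⟨m, r, x, rfl⟩
  calc (QuotientAddGroup.mk (∑ i, _) : BalancedTensor R M N)
      = ∑ i, ∑ k, (QuotientAddGroup.mk (m i ⊗ₜ[ℤ] (A i k • e • x k)) : BalancedTensor R M N) := by
        simp only [LinearMap.lTensor_tmul, AddMonoidHom.coe_toIntLinearMap,
          DistribSMul.toAddMonoidHom_apply, key, TensorProduct.tmul_sum, QuotientAddGroup.mk_sum]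
    _ = ∑ k, (QuotientAddGroup.mk ((∑ i, MulOpposite.op (A i k) • m i) ⊗ₜ[ℤ] (e • x k)) :
          BalancedTensor R M N) := by
        rw [Finset.sum_comm]
        simp only [hbal, TensorProduct.sum_tmul, QuotientAddGroup.mk_sum]
    _ = 0 := by simp [hm]

end Vanishing

/-! ### Retractions with central local units and reduction of modules -/

/-- A retraction `proj : R → S` of rings with section `incl`, whose kernel is the increasing union
of the ideals `unit n * R` generated by central idempotents. -/
structure LocalUnitRetraction (R S : Type*) [Ring R] [Ring S] where
  /-- The section of the retraction. -/
  incl : S →+* R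
  /-- The retraction. -/
  proj : R →+* S
  proj_incl : ∀ s, proj (incl s) = s
  /-- The central idempotents generating the kernel. -/
  unit : ℕ → R
  unit_comm : ∀ n r, unit n * r = r * unit n
  unit_mul_unit : ∀ {m n}, m ≤ n → unit m * unit n = unit m
  proj_unit : ∀ n, proj (unit n) = 0
  exists_unit_mul : ∀ {r}, proj r = 0 → ∃ n, unit n * r = r

namespace LocalUnitRetraction

section Modules

variable {R S : Type*} [Ring R] [Ring S] (D : LocalUnitRetraction R S)

/-- The retraction between the opposite rings, which governs right modules. -/
def op : LocalUnitRetraction Rᵐᵒᵖ Sᵐᵒᵖ where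
  incl := D.incl.op
  proj := D.proj.op
  proj_incl s := MulOpposite.unop_injective (D.proj_incl s.unop)
  unit n := MulOpposite.op (D.unit n)
  unit_comm n r := MulOpposite.unop_injective (D.unit_comm n r.unop).symm
  unit_mul_unit {m n} h := MulOpposite.unop_injective
    ((D.unit_comm m (D.unit n)).symm.trans (D.unit_mul_unit h))
  proj_unit n := MulOpposite.unop_injective (D.proj_unit n)
  exists_unit_mul {r} h := by
    obtain ⟨n, hn⟩ := D.exists_unit_mul (r := r.unop) (MulOpposite.op_injective h)
    exact ⟨n, MulOpposite.unop_injective ((D.unit_comm n _).symm.trans hn)⟩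

instance : RingHomSurjective D.proj := ⟨fun s => ⟨D.incl s, D.proj_incl s⟩⟩

variable {M C : Type*} [AddCommGroup M] [Module R M] [AddCommGroup C] [Module S C]

theorem unit_smul_of_le {m n : ℕ} (h : m ≤ n) {x : M} (hx : D.unit m • x = x) :
    D.unit n • x = x := by
  rw [← hx, smul_smul, D.unit_comm, D.unit_mul_unit h]

theorem unit_smul_unit_smul (n : ℕ) (x : M) : D.unit n • D.unit n • x = D.unit n • x := by
  rw [smul_smul, D.unit_mul_unit le_rfl]

/-- The submodule `M I` of a module `M`, where `I` is the kernel of the retraction: the elements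
fixed by one of the local units. -/
def torsion (M : Type*) [AddCommGroup M] [Module R M] : Submodule R M where
  carrier := {x | ∃ n, D.unit n • x = x}
  add_mem' := by
    rintro x y ⟨m, hx⟩ ⟨n, hy⟩
    exact ⟨max m n, by rw [smul_add, D.unit_smul_of_le (le_max_left m n) hx,
      D.unit_smul_of_le (le_max_right m n) hy]⟩
  zero_mem' := ⟨0, smul_zero _⟩
  smul_mem' := by
    rintro r x ⟨n, hx⟩
    exact ⟨n, by rw [smul_smul, D.unit_comm, ← smul_smul, hx]⟩

theorem unit_smul_mem_torsion (n : ℕ) (x : M) : D.unit n • x ∈ D.torsion M :=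
  ⟨n, D.unit_smul_unit_smul n x⟩

theorem mem_torsion_of_map {M' : Type*} [AddCommGroup M'] [Module R M'] {f : M →ₗ[R] M'}
    (hf : Function.Injective f) {x : M} (hx : f x ∈ D.torsion M') : x ∈ D.torsion M := by
  obtain ⟨n, hn⟩ := hx
  exact ⟨n, hf (by rw [map_smul, hn])⟩

variable {D} in
theorem map_eq_zero_of_mem_torsion (q : M →ₛₗ[D.proj] C) {x : M} (hx : x ∈ D.torsion M) :
    q x = 0 := by
  obtain ⟨n, hn⟩ := hx
  rw [← hn, q.map_smulₛₗ, D.proj_unit, zero_smul]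

variable {D} in
/-- A semilinear map `q : M → C` exhibiting the `S`-module `C` as the quotient `M / M I`, where `I`
is the kernel of the retraction `R → S`. -/
structure IsReduction (q : M →ₛₗ[D.proj] C) : Prop where
  surjective : Function.Surjective q
  mem_torsion : ∀ {x}, q x = 0 → x ∈ D.torsion M

variable {D} in
/-- The universal property of the reduction: semilinear maps into `S`-modules factor through it. -/
theorem IsReduction.exists_lift {q : M →ₛₗ[D.proj] C} (hq : IsReduction q)
    {X : Type*} [AddCommGroup X] [Module S X] (k : M →ₛₗ[D.proj] X) :
    ∃ g : C →ₗ[S] X, ∀ x, g (q x) = k x := by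
  have hk {x y : M} (h : q x = q y) : k x = k y := by
    rw [← sub_eq_zero, ← map_sub] at h ⊢
    exact map_eq_zero_of_mem_torsion k (hq.mem_torsion h)
  have hs := Function.surjInv_eq hq.surjective
  refine ⟨{ toFun := fun c => k (Function.surjInv hq.surjective c)
            map_add' := fun c d => ?_
            map_smul' := fun s c => ?_ }, fun x => hk (hs _)⟩
  · rw [← map_add]
    exact hk (by rw [map_add, hs, hs, hs])
  · have : s • k (Function.surjInv hq.surjective c) =
        k (D.incl s • Function.surjInv hq.surjective c) := by
      rw [k.map_smulₛₗ, D.proj_incl]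
    rw [RingHom.id_apply, this]
    exact hk (by rw [q.map_smulₛₗ, D.proj_incl, hs, hs])

/-- The quotient `M / M I` as a module over `S`. -/
def Reduction (D : LocalUnitRetraction R S) (M : Type*) [AddCommGroup M] [Module R M] : Type _ :=
  M ⧸ D.torsion M

instance : AddCommGroup (D.Reduction M) := inferInstanceAs (AddCommGroup (M ⧸ D.torsion M))

instance : Module S (D.Reduction M) := Module.compHom (M ⧸ D.torsion M) D.incl

/-- The quotient map from `M` to `M / M I`. -/
def toReduction (M : Type*) [AddCommGroup M] [Module R M] : M →ₛₗ[D.proj] D.Reduction M where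
  toFun := (D.torsion M).mkQ
  map_add' := map_add _
  map_smul' r x := by
    change (D.torsion M).mkQ (r • x) = (D.torsion M).mkQ (D.incl (D.proj r) • x)
    rw [← sub_eq_zero, ← map_sub, ← sub_smul, ← LinearMap.mem_ker, Submodule.ker_mkQ]
    obtain ⟨n, hn⟩ := D.exists_unit_mul (r := r - D.incl (D.proj r))
      (by rw [map_sub, D.proj_incl, sub_self])
    exact ⟨n, by rw [smul_smul, hn]⟩

theorem isReduction_toReduction (M : Type*) [AddCommGroup M] [Module R M] :
    IsReduction (D.toReduction M) where
  surjective := (D.torsion M).mkQ_surjective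
  mem_torsion hx := (Submodule.Quotient.mk_eq_zero (D.torsion M)).1 hx

/-- An `S`-module, regarded as an `R`-module by restriction of scalars along `proj`. -/
def Inflation (_ : LocalUnitRetraction R S) (C : Type*) : Type _ := C

instance : AddCommGroup (D.Inflation C) := inferInstanceAs (AddCommGroup C)

instance : Module R (D.Inflation C) := Module.compHom C D.proj

/-- The identity map from the inflation of `C` to `C`. -/
def ofInflation (C : Type*) [AddCommGroup C] [Module S C] :
    D.Inflation C →ₛₗ[D.proj] C where
  toFun := id
  map_add' _ _ := rfl
  map_smul' _ _ := rfl

/-- A linear map of `S`-modules, regarded as a map of `R`-modules. -/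
def inflationMap {C' : Type*} [AddCommGroup C'] [Module S C'] (f : C →ₗ[S] C') :
    D.Inflation C →ₗ[R] D.Inflation C' where
  toFun := f
  map_add' := f.map_add
  map_smul' r := f.map_smul (D.proj r)

end Modules

/-! ### Flatness can be tested on reductions -/

section Flat

variable {R S : Type u} [Ring R] [Ring S] {D : LocalUnitRetraction R S}
  {M C : Type v} [AddCommGroup M] [Module Rᵐᵒᵖ M] [AddCommGroup C] [Module Sᵐᵒᵖ C]

section TensorMap

variable {N E : Type w} [AddCommGroup N] [Module R N] [AddCommGroup E] [Module S E]

/-- The map `M ⊗[ℤ] N → C ⊗[ℤ] E` induced by two semilinear maps. -/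
noncomputable def tensorMap (p : M →ₛₗ[D.op.proj] C) (q : N →ₛₗ[D.proj] E) :
    M ⊗[ℤ] N →ₗ[ℤ] C ⊗[ℤ] E :=
  TensorProduct.map p.toAddMonoidHom.toIntLinearMap q.toAddMonoidHom.toIntLinearMap

theorem tensorMap_tmul (p : M →ₛₗ[D.op.proj] C) (q : N →ₛₗ[D.proj] E) (m : M) (n : N) :
    tensorMap p q (m ⊗ₜ n) = p m ⊗ₜ q n := rfl

theorem tensorMap_mem (p : M →ₛₗ[D.op.proj] C) (q : N →ₛₗ[D.proj] E) {z : M ⊗[ℤ] N}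
    (hz : z ∈ balancingRelations R M N) : tensorMap p q z ∈ balancingRelations S C E := by
  suffices balancingRelations R M N ≤
      (balancingRelations S C E).comap (tensorMap p q).toAddMonoidHom from this hz
  refine (AddSubgroup.closure_le _).2 ?_
  rintro _ ⟨m, r, n, rfl⟩
  refine AddSubgroup.subset_closure ⟨p m, D.proj r, q n, ?_⟩
  rw [LinearMap.toAddMonoidHom_coe, map_sub, tensorMap_tmul, tensorMap_tmul,
    p.map_smulₛₗ, q.map_smulₛₗ]
  rfl

theorem tensorMap_lTensor {N' E' : Type w} [AddCommGroup N'] [Module R N'] [AddCommGroup E']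
    [Module S E'] (p : M →ₛₗ[D.op.proj] C) (q : N →ₛₗ[D.proj] E) (q' : N' →ₛₗ[D.proj] E')
    {f : N →ₗ[R] N'} {g : E →ₗ[S] E'} (h : ∀ n, q' (f n) = g (q n)) (z : M ⊗[ℤ] N) :
    tensorMap p q' (f.toAddMonoidHom.toIntLinearMap.lTensor M z) =
      g.toAddMonoidHom.toIntLinearMap.lTensor C (tensorMap p q z) := by
  induction z with
  | zero => simp only [map_zero]
  | tmul m n => exact congr_arg (p m ⊗ₜ[ℤ] ·) (h n)
  | add x y hx hy => simp only [map_add, hx, hy]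

/-- A tensor that becomes zero in `C ⊗_S E` lies in the subgroup generated by the balancing
relations over `R` and the pure tensors with a factor in the kernel of `p` or `q`. -/
theorem mem_of_tensorMap_mem {p : M →ₛₗ[D.op.proj] C} {q : N →ₛₗ[D.proj] E}
    (hp : Function.Surjective p) (hq : Function.Surjective q) {L : AddSubgroup (M ⊗[ℤ] N)}
    (hL : balancingRelations R M N ≤ L) (hpL : ∀ m n, p m = 0 → m ⊗ₜ[ℤ] n ∈ L)
    (hqL : ∀ m n, q n = 0 → m ⊗ₜ[ℤ] n ∈ L) {z : M ⊗[ℤ] N}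
    (hz : tensorMap p q z ∈ balancingRelations S C E) : z ∈ L := by
  have hle : balancingRelations S C E ≤
      (balancingRelations R M N).map (tensorMap p q).toAddMonoidHom := by
    refine (AddSubgroup.closure_le _).2 ?_
    rintro _ ⟨c, s, e, rfl⟩
    obtain ⟨m, rfl⟩ := hp c
    obtain ⟨n, rfl⟩ := hq e
    refine ⟨_, AddSubgroup.subset_closure ⟨m, D.incl s, n, rfl⟩, ?_⟩
    rw [LinearMap.toAddMonoidHom_coe, map_sub, tensorMap_tmul, tensorMap_tmul,
      p.map_smulₛₗ, q.map_smulₛₗ, D.proj_incl]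
    congr 3
    exact D.op.proj_incl (MulOpposite.op s)
  obtain ⟨z', hz', h⟩ := hle hz
  let p' := p.toAddMonoidHom.toIntLinearMap
  let q' := q.toAddMonoidHom.toIntLinearMap
  have hker : z - z' ∈ LinearMap.ker (TensorProduct.map p' q') :=
    (LinearMap.sub_mem_ker_iff).2 h.symm
  rw [TensorProduct.map_ker (LinearMap.exact_subtype_ker_map p') hp
    (LinearMap.exact_subtype_ker_map q') hq] at hker
  suffices LinearMap.range (LinearMap.lTensor M (LinearMap.ker q').subtype) ⊔
      LinearMap.range (LinearMap.rTensor N (LinearMap.ker p').subtype) ≤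
      L.toIntSubmodule by
    simpa using L.add_mem (this hker) (hL hz')
  refine sup_le ?_ ?_ <;> rintro _ ⟨y, rfl⟩
  · induction y with
    | zero => rw [map_zero]; exact zero_mem _
    | tmul m n => exact hqL m n n.2
    | add x y hx hy => rw [map_add]; exact add_mem hx hy
  · induction y with
    | zero => rw [map_zero]; exact zero_mem _
    | tmul m n => exact hpL m n m.2
    | add x y hx hy => rw [map_add]; exact add_mem hx hy

end TensorMap

theorem isRightFlat_iff_forall_mem {R : Type u} [Ring R] {M : Type v} [AddCommGroup M]
    [Module Rᵐᵒᵖ M] : IsRightFlat R M ↔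
      ∀ (N N' : Type u) [AddCommGroup N] [Module R N] [AddCommGroup N'] [Module R N']
        (f : N →ₗ[R] N'), Function.Injective f → ∀ z : M ⊗[ℤ] N,
        f.toAddMonoidHom.toIntLinearMap.lTensor M z ∈ balancingRelations R M N' →
        z ∈ balancingRelations R M N := by
  refine forall₂_congr fun N N' => forall₄_congr fun _ _ _ _ => forall₂_congr fun f _ => ?_
  rw [injective_iff_map_eq_zero]
  refine ⟨fun h z hz => ?_, fun h z hz => ?_⟩
  · exact (QuotientAddGroup.eq_zero_iff z).1 (h z ((QuotientAddGroup.eq_zero_iff _).2 hz))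
  · induction z using QuotientAddGroup.induction_on with
    | H z =>
      exact (QuotientAddGroup.eq_zero_iff z).2 (h z ((QuotientAddGroup.eq_zero_iff _).1 hz))

theorem op_smul_tmul_sub_mem (m : M) (r : R) {N : Type w} [AddCommGroup N] [Module R N] (n : N) :
    (MulOpposite.op r • m) ⊗ₜ[ℤ] n - m ⊗ₜ[ℤ] (r • n) ∈ balancingRelations R M N :=
  AddSubgroup.subset_closure ⟨m, r, n, rfl⟩

/-- The reduction of a flat module is flat. -/
theorem IsReduction.isRightFlat {p : M →ₛₗ[D.op.proj] C} (hp : IsReduction p)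
    (hM : IsRightFlat R M) : IsRightFlat S C := by
  rw [isRightFlat_iff_forall_mem] at hM ⊢
  intro E E' _ _ _ _ f hf z hz
  have hsurj : Function.Surjective (tensorMap p (D.ofInflation E)) :=
    TensorProduct.map_surjective hp.surjective Function.surjective_id
  obtain ⟨z, rfl⟩ := hsurj z
  refine tensorMap_mem p (D.ofInflation E) (hM _ _ (D.inflationMap f) hf z ?_)
  refine mem_of_tensorMap_mem hp.surjective (q := D.ofInflation E') Function.surjective_id le_rfl
    (fun m n hm => ?_) (fun m n hn => ?_) ?_
  · obtain ⟨k, hk⟩ := hp.mem_torsion hm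
    have hn : D.unit k • n = 0 := (congr_arg (· • D.ofInflation E' n) (D.proj_unit k)).trans
      (zero_smul _ _)
    have := op_smul_tmul_sub_mem m (D.unit k) n
    rwa [hn, TensorProduct.tmul_zero, sub_zero, show MulOpposite.op (D.unit k) • m = m from hk]
      at this
  · rw [show n = 0 from hn, TensorProduct.tmul_zero]
    exact zero_mem _
  · rwa [tensorMap_lTensor p (D.ofInflation E) (D.ofInflation E') (g := f) fun _ => rfl]

/-- The ideals generated by the local units are von Neumann regular, in the form that matrices
over `R` have generalized inverses up to multiplication by a local unit. The universes of the index
types are those of the matrices in `exists_matrix_of_lTensor_mem_balancingRelations`. -/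
def IsLocallyRegular (D : LocalUnitRetraction R S) : Prop :=
  ∀ (n : ℕ) {ι : Type} {κ : Type u} [Fintype ι] [Fintype κ] (A : Matrix ι κ R),
    ∃ B : Matrix κ ι R, D.unit n • (A * B * A) = D.unit n • A

/-- If the kernel of the retraction is regular, then a module with flat reduction is flat. -/
theorem IsReduction.isRightFlat_of_isLocallyRegular (hD : D.IsLocallyRegular)
    {p : M →ₛₗ[D.op.proj] C} (hp : IsReduction p) (hC : IsRightFlat S C) : IsRightFlat R M := by
  rw [isRightFlat_iff_forall_mem] at hC ⊢
  intro N N' _ _ _ _ f hf z hz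
  -- The tensors that are fixed modulo the relations by one of the local units.
  let U (k : ℕ) : M ⊗[ℤ] N →ₗ[ℤ] M ⊗[ℤ] N :=
    (DistribSMul.toAddMonoidHom N (D.unit k)).toIntLinearMap.lTensor M
  have hUtmul (k m n) : U k (m ⊗ₜ n) = m ⊗ₜ (D.unit k • n) := rfl
  have hU (k : ℕ) : U k z ∈ balancingRelations R M N :=
    smul_mem_balancingRelations_of_regular (D.unit_comm k) (hD k) f hf hz
  have hUmem (k : ℕ) {w : M ⊗[ℤ] N} (hw : w ∈ balancingRelations R M N) :
      U k w ∈ balancingRelations R M N := by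
    suffices balancingRelations R M N ≤ (balancingRelations R M N).comap (U k).toAddMonoidHom from
      this hw
    refine (AddSubgroup.closure_le _).2 ?_
    rintro _ ⟨m, r, n, rfl⟩
    refine AddSubgroup.subset_closure ⟨m, r, D.unit k • n, ?_⟩
    rw [LinearMap.toAddMonoidHom_coe, map_sub, hUtmul, hUtmul, smul_smul, smul_smul, D.unit_comm]
  have hUU {k l : ℕ} (h : k ≤ l) (w : M ⊗[ℤ] N) : U l (U k w) = U k w := by
    induction w with
    | zero => simp only [map_zero]
    | tmul m n => rw [hUtmul, hUtmul, D.unit_smul_of_le h (D.unit_smul_unit_smul k n)]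
    | add x y hx hy => simp only [map_add, hx, hy]
  have hmono {k l : ℕ} (h : k ≤ l) {w : M ⊗[ℤ] N} (hw : w - U k w ∈ balancingRelations R M N) :
      w - U l w ∈ balancingRelations R M N := by
    have := sub_mem hw (hUmem l hw)
    rwa [map_sub, hUU h, sub_sub_sub_cancel_right] at this
  let L : AddSubgroup (M ⊗[ℤ] N) :=
    { carrier := {w | ∃ k, w - U k w ∈ balancingRelations R M N}
      add_mem' := by
        rintro x y ⟨k, hx⟩ ⟨l, hy⟩
        refine ⟨max k l, ?_⟩
        rw [map_add, add_sub_add_comm]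
        exact add_mem (hmono (le_max_left k l) hx) (hmono (le_max_right k l) hy)
      zero_mem' := ⟨0, by rw [map_zero, sub_zero]; exact zero_mem _⟩
      neg_mem' := by
        rintro x ⟨k, hx⟩
        refine ⟨k, ?_⟩
        rw [map_neg, ← neg_sub_neg, neg_neg, neg_neg, ← neg_sub]
        exact neg_mem hx }
  obtain ⟨g, hg⟩ := (D.isReduction_toReduction N).exists_lift ((D.toReduction N').comp f)
  have hginj : Function.Injective g := by
    refine (injective_iff_map_eq_zero g).2 fun x hx => ?_
    obtain ⟨n, rfl⟩ := (D.isReduction_toReduction N).surjective x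
    rw [hg] at hx
    exact map_eq_zero_of_mem_torsion _
      (D.mem_torsion_of_map hf ((D.isReduction_toReduction N').mem_torsion hx))
  have hzL : z ∈ L := by
    refine mem_of_tensorMap_mem (L := L) hp.surjective (D.isReduction_toReduction N).surjective
      (fun w hw => ⟨0, sub_mem hw (hUmem 0 hw)⟩) (fun m n hm => ?_) (fun m n hn => ?_)
      (hC _ _ g hginj _ ?_)
    · obtain ⟨k, hk⟩ := hp.mem_torsion hm
      refine ⟨k, ?_⟩
      have := op_smul_tmul_sub_mem m (D.unit k) n
      rwa [show MulOpposite.op (D.unit k) • m = m from hk] at this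
    · obtain ⟨k, hk⟩ := (D.isReduction_toReduction N).mem_torsion hn
      refine ⟨k, ?_⟩
      rw [hUtmul, hk, sub_self]
      exact zero_mem _
    · rw [← tensorMap_lTensor p (D.toReduction N) (D.toReduction N') fun n => (hg n).symm]
      exact tensorMap_mem _ _ hz
  obtain ⟨k, hk⟩ := hzL
  simpa using add_mem hk (hU k)

end Flat

end LocalUnitRetraction

namespace LocalUnitRetraction

/-! ### Pullbacks along reductions and small submodules -/

section Pullback

variable {R S : Type*} [Ring R] [Ring S] {D : LocalUnitRetraction R S}
  {M M' C X : Type*} [AddCommGroup M] [Module R M] [AddCommGroup M'] [Module R M']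
  [AddCommGroup C] [Module S C] [AddCommGroup X] [Module S X]

/-- The pullback `M ×_C X` of a semilinear map `q : M → C` and a homomorphism `g : X → C` of
`S`-modules, as an `R`-module. -/
def pullback (q : M →ₛₗ[D.proj] C) (g : X →ₗ[S] C) : Submodule R (M × D.Inflation X) where
  carrier := {a | q a.1 = g (D.ofInflation X a.2)}
  add_mem' {a b} ha hb := by
    change q (a.1 + b.1) = g (D.ofInflation X (a.2 + b.2))
    rw [map_add, map_add, map_add, ha, hb]
  zero_mem' := by
    change q 0 = g (D.ofInflation X 0)
    rw [map_zero, map_zero, map_zero]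
  smul_mem' r a ha := by
    change q (r • a.1) = g (D.ofInflation X (r • a.2))
    rw [q.map_smulₛₗ, (D.ofInflation X).map_smulₛₗ, map_smul, ha]

variable (q : M →ₛₗ[D.proj] C) (g : X →ₗ[S] C)

/-- The first projection of the pullback. -/
def pullbackFst : pullback q g →ₗ[R] M :=
  LinearMap.fst R M (D.Inflation X) ∘ₗ (pullback q g).subtype

/-- The second projection of the pullback. -/
def pullbackSnd : pullback q g →ₛₗ[D.proj] X :=
  (D.ofInflation X).comp (LinearMap.snd R M (D.Inflation X) ∘ₗ (pullback q g).subtype)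

variable {q g}

theorem pullback_condition (a : pullback q g) : q (pullbackFst q g a) = g (pullbackSnd q g a) :=
  a.2

theorem pullback_ext {a b : pullback q g} (h₁ : pullbackFst q g a = pullbackFst q g b)
    (h₂ : pullbackSnd q g a = pullbackSnd q g b) : a = b :=
  Subtype.ext (Prod.ext h₁ h₂)

theorem exists_pullback_eq {m : M} {x : X} (h : q m = g x) :
    ∃ a : pullback q g, pullbackFst q g a = m ∧ pullbackSnd q g a = x :=
  ⟨⟨(m, x), h⟩, rfl, rfl⟩

theorem exists_pullback_lift (h₁ : M' →ₗ[R] M) (h₂ : M' →ₛₗ[D.proj] X)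
    (h : ∀ x, q (h₁ x) = g (h₂ x)) : ∃ k : M' →ₗ[R] pullback q g,
      (∀ x, pullbackFst q g (k x) = h₁ x) ∧ ∀ x, pullbackSnd q g (k x) = h₂ x :=
  ⟨{ toFun := fun x => ⟨(h₁ x, h₂ x), h x⟩
     map_add' := fun x y => pullback_ext (map_add h₁ x y) (map_add h₂ x y)
     map_smul' := fun r x => pullback_ext (map_smul h₁ r x)
      (h₂.map_smulₛₗ r x) },
    fun _ => rfl, fun _ => rfl⟩

/-- The pullback of a reduction `M → C` along `X → C` has reduction `X`. -/
theorem isReduction_pullbackSnd (hq : IsReduction q) : IsReduction (pullbackSnd q g) where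
  surjective x := by
    obtain ⟨m, hm⟩ := hq.surjective (g x)
    obtain ⟨a, -, ha⟩ := exists_pullback_eq hm
    exact ⟨a, ha⟩
  mem_torsion {a} ha := by
    have h := pullback_condition a
    rw [ha, map_zero] at h
    obtain ⟨n, hn⟩ := hq.mem_torsion h
    refine ⟨n, pullback_ext ?_ ?_⟩
    · rw [map_smul, hn]
    · rw [(pullbackSnd q g).map_smulₛₗ, ha, smul_zero]

/-- Smallness lifts along a reduction for submodules meeting the torsion trivially: such a
submodule is annihilated by the local units, so every complement contains the torsion. -/
theorem IsReduction.isSmallSubmodule (hq : IsReduction q) {K : Submodule R M}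
    (hK : ∀ x ∈ K, x ∈ D.torsion M → x = 0) {L : Submodule S C} (hL : IsSmallSubmodule L)
    (hKL : ∀ x ∈ K, q x ∈ L) : IsSmallSubmodule K := by
  intro Y hY
  have htors {x : M} (hx : x ∈ D.torsion M) : x ∈ Y := by
    obtain ⟨n, hn⟩ := hx
    obtain ⟨k, hk, y, hy, rfl⟩ := Submodule.mem_sup.1 (hY ▸ Submodule.mem_top : x ∈ K ⊔ Y)
    have hk0 : D.unit n • k = 0 :=
      hK _ (K.smul_mem _ hk) (D.unit_smul_mem_torsion n k)
    rw [← hn, smul_add, hk0, zero_add]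
    exact Y.smul_mem _ hy
  have hmap : Y.map q = ⊤ := by
    refine hL _ (eq_top_iff.2 fun c _ => ?_)
    obtain ⟨x, rfl⟩ := hq.surjective c
    obtain ⟨k, hk, y, hy, rfl⟩ := Submodule.mem_sup.1 (hY ▸ Submodule.mem_top : x ∈ K ⊔ Y)
    rw [map_add]
    exact add_mem (Submodule.mem_sup_left (hKL k hk))
      (Submodule.mem_sup_right (Submodule.mem_map_of_mem hy))
  refine eq_top_iff.2 fun x _ => ?_
  obtain ⟨y, hy, hxy⟩ := (hmap ▸ Submodule.mem_top : q x ∈ Y.map q)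
  rw [← sub_add_cancel x y]
  exact add_mem (htors (hq.mem_torsion (by rw [map_sub, hxy, sub_self]))) hy

/-- The map induced on reductions by a bijective endomorphism is bijective. -/
theorem IsReduction.bijective_of_bijective (hq : IsReduction q) {φ : M →ₗ[R] M}
    (hφ : Function.Bijective φ) {ψ : C →ₗ[S] C} (h : ∀ x, ψ (q x) = q (φ x)) :
    Function.Bijective ψ := by
  refine ⟨(injective_iff_map_eq_zero ψ).2 fun c hc => ?_, fun c => ?_⟩
  · obtain ⟨x, rfl⟩ := hq.surjective c
    rw [h] at hc
    exact map_eq_zero_of_mem_torsion q (D.mem_torsion_of_map hφ.1 (hq.mem_torsion hc))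
  · obtain ⟨x, rfl⟩ := hq.surjective c
    obtain ⟨y, rfl⟩ := hφ.2 x
    exact ⟨q y, h y⟩

end Pullback

/-! ### Transfer of covers -/

section Covers

variable {R S : Type u} [Ring R] [Ring S] {D : LocalUnitRetraction R S}

/-- The pullback of a G-flat cover of the reduction of `M` is a G-flat cover of `M`. -/
theorem IsReduction.isGFlatCover_pullbackFst (hD : D.IsLocallyRegular)
    {M C X : Type v} [AddCommGroup M] [Module Rᵐᵒᵖ M] [AddCommGroup C] [Module Sᵐᵒᵖ C]
    [AddCommGroup X] [Module Sᵐᵒᵖ X] {q : M →ₛₗ[D.op.proj] C} (hq : IsReduction q)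
    {g : X →ₗ[Sᵐᵒᵖ] C} (hg : IsGFlatCover S g) :
    IsGFlatCover R (pullbackFst q g) where
  flat := (isReduction_pullbackSnd hq).isRightFlat_of_isLocallyRegular hD hg.flat
  surjective m := by
    obtain ⟨x, hx⟩ := hg.surjective (q m)
    obtain ⟨a, ha, -⟩ := exists_pullback_eq hx.symm
    exact ⟨a, ha⟩
  small_ker := by
    refine (isReduction_pullbackSnd hq).isSmallSubmodule (fun a ha ht => pullback_ext ?_ ?_)
      hg.small_ker fun a ha => ?_
    · rw [LinearMap.mem_ker.1 ha, map_zero]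
    · rw [map_eq_zero_of_mem_torsion _ ht, map_zero]
    · rw [LinearMap.mem_ker, ← pullback_condition, LinearMap.mem_ker.1 ha, map_zero]

theorem isRightGPerfect (hD : D.IsLocallyRegular) (hS : IsRightGPerfect.{u, v} S) :
    IsRightGPerfect.{u, v} R := by
  intro M _ _
  obtain ⟨X, _, _, g, hg⟩ := hS (D.op.Reduction M)
  exact ⟨_, _, _, _, (D.op.isReduction_toReduction M).isGFlatCover_pullbackFst hD hg⟩

variable {F M : Type v} [AddCommGroup F] [Module Rᵐᵒᵖ F] [AddCommGroup M] [Module Rᵐᵒᵖ M]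
  {G C : Type v} [AddCommGroup G] [Module Sᵐᵒᵖ G] [AddCommGroup C] [Module Sᵐᵒᵖ C]
  {qF : F →ₛₗ[D.op.proj] G} {qM : M →ₛₗ[D.op.proj] C} {f : F →ₗ[Rᵐᵒᵖ] M} {g : G →ₗ[Sᵐᵒᵖ] C}

/-- The homomorphism induced by a flat precover on reductions is a flat precover. -/
theorem IsReduction.isFlatPrecover (hD : D.IsLocallyRegular) (hF : IsReduction qF)
    (hM : IsReduction qM) (h : ∀ x, g (qF x) = qM (f x)) (hf : IsFlatPrecover R f) :
    IsFlatPrecover S g where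
  flat := hF.isRightFlat hf.flat
  lift X _ _ hX k := by
    have hP : IsReduction (pullbackSnd qM k) := isReduction_pullbackSnd hM
    obtain ⟨l, hl⟩ := hf.lift _ (hP.isRightFlat_of_isLocallyRegular hD hX) (pullbackFst qM k)
    obtain ⟨l', hl'⟩ := hP.exists_lift (qF.comp l)
    refine ⟨l', LinearMap.ext fun x => ?_⟩
    obtain ⟨a, rfl⟩ := hP.surjective x
    rw [LinearMap.comp_apply, hl', LinearMap.comp_apply, h, ← pullback_condition, ← hl]
    rfl

/-- The homomorphism `g` induced by a flat cover `f : F → M` on reductions is a flat cover, and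
the kernel of `f` meets the torsion of `F` trivially: since the pullback of `M` and the reduction
of `F` is flat, minimality of `f` makes `F` a direct summand of it. -/
theorem IsReduction.isFlatCover (hD : D.IsLocallyRegular) (hF : IsReduction qF)
    (hM : IsReduction qM) (h : ∀ x, g (qF x) = qM (f x)) (hf : IsFlatCover R f) :
    IsFlatCover S g ∧ ∀ x ∈ LinearMap.ker f, x ∈ D.op.torsion F → x = 0 := by
  have hg := hF.isFlatPrecover hD hM h hf.toIsFlatPrecover
  have hP : IsReduction (pullbackSnd qM g) := isReduction_pullbackSnd hM
  obtain ⟨l, hl⟩ := hf.lift _ (hP.isRightFlat_of_isLocallyRegular hD hg.flat) (pullbackFst qM g)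
  have hl (a) : f (l a) = pullbackFst qM g a := LinearMap.congr_fun hl a
  obtain ⟨l', hl'⟩ := hP.exists_lift (qF.comp l)
  -- Every endomorphism `k` of `G` over `C` yields an endomorphism of `F` over `M`, with reduction
  -- `l' ∘ k`, that factors through the pullback.
  have key (k : G →ₗ[Sᵐᵒᵖ] G) (hk : g = g ∘ₗ k) : Function.Bijective (l' ∘ₗ k) ∧
      ∃ s : F →ₗ[Rᵐᵒᵖ] pullback qM g, Function.Injective s ∧
        (∀ x, pullbackFst qM g (s x) = f x) ∧ ∀ x, pullbackSnd qM g (s x) = k (qF x) := by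
    obtain ⟨s, hs₁, hs₂⟩ := exists_pullback_lift (q := qM) (g := g) f (k.comp qF) fun x =>
      (h x).symm.trans (LinearMap.congr_fun hk _)
    have hbij : Function.Bijective (l ∘ₗ s) :=
      hf.minimal _ (LinearMap.ext fun x => ((hl _).trans (hs₁ x)).symm)
    refine ⟨hF.bijective_of_bijective hbij fun x => ?_, s,
      Function.Injective.of_comp (f := l) hbij.1, hs₁, hs₂⟩
    rw [LinearMap.comp_apply, ← LinearMap.comp_apply k, ← hs₂, hl']
    rfl
  obtain ⟨hbij, s, hs, hs₁, hs₂⟩ := key LinearMap.id rfl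
  refine ⟨⟨hg, fun k hk => ?_⟩, fun x hx ht => hs (pullback_ext ?_ ?_)⟩
  · exact (Function.Bijective.of_comp_iff' (f := l') hbij k).1 (key k hk).1
  · rw [hs₁, LinearMap.mem_ker.1 hx, map_zero, map_zero]
  · rw [hs₂, map_eq_zero_of_mem_torsion qF ht, map_zero, map_zero, map_zero]

theorem flatCoversAreGFlatCovers (hD : D.IsLocallyRegular) (hR : IsRightGPerfect.{u, v} R)
    (hS : FlatCoversAreGFlatCovers.{u, v} S) : FlatCoversAreGFlatCovers.{u, v} R := by
  intro F M _ _ _ _ f hf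
  have hF := D.op.isReduction_toReduction F
  have hM := D.op.isReduction_toReduction M
  obtain ⟨g, hg⟩ := hF.exists_lift ((D.op.toReduction M).comp f)
  obtain ⟨hcover, hker⟩ := hF.isFlatCover hD hM hg hf
  refine ⟨hf.flat, fun m => ?_, ?_⟩
  · -- A precover is onto as soon as some flat module maps onto `M`.
    obtain ⟨P, _, _, p, hp⟩ := hR M
    obtain ⟨x, rfl⟩ := hp.surjective m
    obtain ⟨l, rfl⟩ := hf.lift P hp.flat p
    exact ⟨l x, rfl⟩
  · refine hF.isSmallSubmodule hker (hS _ _ g hcover).small_ker fun x hx => ?_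
    rw [LinearMap.mem_ker, hg, LinearMap.comp_apply, LinearMap.mem_ker.1 hx, map_zero]

end Covers

end LocalUnitRetraction

/-! ### The ring of eventually constant sequences -/

section EventuallyConstant

variable {T : Type u} [Ring T] (S : Subring T)

theorem exists_eventually_eq (a : eventuallyConstantSubring S) :
    ∃ x : S, ∃ n : ℕ, ∀ i, n ≤ i → a.1 i = x := by
  obtain ⟨x, hx, h⟩ := a.2
  exact ⟨⟨x, hx⟩, h⟩

/-- The eventual value of an eventually constant sequence. -/
noncomputable def eventualValue (a : eventuallyConstantSubring S) : S :=
  (exists_eventually_eq S a).choose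

theorem exists_eq_eventualValue (a : eventuallyConstantSubring S) :
    ∃ n : ℕ, ∀ i, n ≤ i → a.1 i = eventualValue S a :=
  (exists_eventually_eq S a).choose_spec

theorem eventualValue_eq {a : eventuallyConstantSubring S} {x : S} {n : ℕ}
    (h : ∀ i, n ≤ i → a.1 i = x) : eventualValue S a = x := by
  obtain ⟨m, hm⟩ := exists_eq_eventualValue S a
  exact Subtype.ext ((hm _ (le_max_left m n)).symm.trans (h _ (le_max_right m n)))

/-- A sequence in `T` truncated to the indices `i < n`. -/
def truncate (n : ℕ) (b : ℕ → T) : eventuallyConstantSubring S :=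
  ⟨fun i => if i < n then b i else 0, 0, S.zero_mem, n, fun _ hi => if_neg hi.not_gt⟩

theorem truncate_apply (n : ℕ) (b : ℕ → T) (i : ℕ) :
    (truncate S n b).1 i = if i < n then b i else 0 := rfl

/-- Taking eventual values is a retraction of the eventually constant sequences onto the constant
ones, and its kernel is generated by the central idempotents `(1, …, 1, 0, 0, …)`. -/
noncomputable def eventuallyConstantRetraction :
    LocalUnitRetraction (eventuallyConstantSubring S) S where
  incl :=
    { toFun := fun x => ⟨fun _ => x, x, x.2, 0, fun _ _ => rfl⟩
      map_one' := rfl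
      map_mul' := fun _ _ => rfl
      map_zero' := rfl
      map_add' := fun _ _ => rfl }
  proj :=
    { toFun := eventualValue S
      map_one' := eventualValue_eq S (n := 0) fun _ _ => rfl
      map_mul' := fun a b => by
        obtain ⟨m, hm⟩ := exists_eq_eventualValue S a
        obtain ⟨n, hn⟩ := exists_eq_eventualValue S b
        exact eventualValue_eq S (n := max m n) fun i hi => congr_arg₂ (· * ·)
          (hm i (le_of_max_le_left hi)) (hn i (le_of_max_le_right hi))
      map_zero' := eventualValue_eq S (n := 0) fun _ _ => rfl
      map_add' := fun a b => by
        obtain ⟨m, hm⟩ := exists_eq_eventualValue S a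
        obtain ⟨n, hn⟩ := exists_eq_eventualValue S b
        exact eventualValue_eq S (n := max m n) fun i hi => congr_arg₂ (· + ·)
          (hm i (le_of_max_le_left hi)) (hn i (le_of_max_le_right hi)) }
  proj_incl _ := eventualValue_eq S (n := 0) fun _ _ => rfl
  unit n := truncate S n 1
  unit_comm n r := by
    ext i
    change (truncate S n 1).1 i * r.1 i = r.1 i * (truncate S n 1).1 i
    rw [truncate_apply]
    split_ifs <;> simp
  unit_mul_unit {m n} h := by
    ext i
    change (truncate S m 1).1 i * (truncate S n 1).1 i = (truncate S m 1).1 i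
    rw [truncate_apply, truncate_apply]
    by_cases hi : i < m
    · simp [hi, hi.trans_le h]
    · simp [hi]
  proj_unit n := eventualValue_eq S (n := n) fun _ hi => if_neg hi.not_gt
  exists_unit_mul {r} h := by
    obtain ⟨n, hn⟩ := exists_eq_eventualValue S r
    refine ⟨n, ?_⟩
    ext i
    change (truncate S n 1).1 i * r.1 i = r.1 i
    rw [truncate_apply]
    split_ifs with hi
    · exact one_mul _
    · rw [hn i (not_lt.1 hi), show eventualValue S r = 0 from h]
      simp

variable {S}

theorem isLocallyRegular_eventuallyConstantRetraction (hT : IsVonNeumannRegularRing T) :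
    (eventuallyConstantRetraction S).IsLocallyRegular := by
  intro n ι κ _ _ A
  choose B hB using fun i : ℕ => hT.exists_matrix_mul_mul κ (A.map fun a => a.1 i)
  refine ⟨Matrix.of fun k j => truncate S n fun i => B i k j, ?_⟩
  ext j k i
  have h := congr_fun₂ (hB i) j k
  simp only [Matrix.mul_apply, Matrix.map_apply] at h
  by_cases hi : i < n
  · simpa [eventuallyConstantRetraction, truncate_apply, Matrix.mul_apply, hi] using h
  · simp [eventuallyConstantRetraction, truncate_apply, hi]

theorem jacobson_eventuallyConstantSubring (hT : IsVonNeumannRegularRing T) :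
    Ring.jacobson (eventuallyConstantSubring S) = ⊥ := by
  refine eq_bot_iff.2 fun a ha => ?_
  rw [← Ideal.jacobson_bot, Ideal.mem_jacobson_iff] at ha
  rw [Ideal.mem_bot]
  ext i
  obtain ⟨b, hb⟩ := hT (a.1 i)
  -- The `i`-th entry of `y * a` is `-e` with `e = b * a i` idempotent, and `1 - e` is left
  -- invertible because `a` lies in the radical; so `e = 0`.
  obtain ⟨z, hz⟩ := ha (truncate S (i + 1) fun _ => -b)
  rw [Ideal.mem_bot] at hz
  have hz : z.1 i * -b * a.1 i + z.1 i - 1 = 0 := by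
    simpa [truncate_apply] using congr_fun (congr_arg Subtype.val hz) i
  have hz' : z.1 i * (1 - b * a.1 i) = 1 := by
    rw [← sub_eq_zero, ← hz]
    noncomm_ring
  have he : (1 - b * a.1 i) * (b * a.1 i) = 0 := by
    rw [sub_mul, one_mul, mul_assoc b, ← mul_assoc (a.1 i), hb, sub_self]
  have h : b * a.1 i = 0 := by
    rw [← one_mul (b * a.1 i), ← hz', mul_assoc, he, mul_zero]
  rw [← hb, mul_assoc, h, mul_zero]
  rfl

end EventuallyConstant

theorem theorem3p5 {T : Type u} [Ring T] (S : Subring T)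
    (hT : IsVonNeumannRegularRing T) (hS : IsRightGPerfect.{u, max u v} S) :
    IsRightGPerfect.{u, max u v} (eventuallyConstantSubring S) ∧
      Ring.jacobson (eventuallyConstantSubring S) = ⊥ ∧
      (FlatCoversAreGFlatCovers.{u, max u v} S →
        FlatCoversAreGFlatCovers.{u, max u v} (eventuallyConstantSubring S)) := by
  have hD := isLocallyRegular_eventuallyConstantRetraction (S := S) hT
  have hR := LocalUnitRetraction.isRightGPerfect hD hS
  exact ⟨hR, jacobson_eventuallyConstantSubring hT,
    LocalUnitRetraction.flatCoversAreGFlatCovers hD hR⟩
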